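/- Let $p$ be a prime, let $\mathcal V^f$ be the category of finite-dimensional $\mathbb F_p$-vector spaces and $\mathcal V$ the category of all $\mathbb F_p$-vector spaces. Let $S$ be a contravariant functor from $\mathcal V^f$ to sets; write $\alpha^*=S(\alpha)$. For $s\in S(V)$ let $\ker(s)$ be the largest subspace of $V$ of the form $\ker\alpha$, where $\alpha:V\to W$ is a linear map with $s=\alpha^*t$ for some $t\in S(W)$; call $s$ regular if $\ker(s)=0$. Assume that $S$ satisfies the weaker noetherianity condition: $\ker(\alpha^*s)=\alpha^{-1}(\ker(s))$ for all $\alpha:U\to V$ in $\mathcal V^f$ and all $s\in S(V)$. Let $\mathfrak S_S$ be the category of elements of $S$: objects are pairs $(W,\psi)$ with $W\in\mathcal V^f$ and $\psi\in S(W)$, morphisms $(W,\psi)\to(H,\eta)$ are linear maps $\gamma:W\to H$ with $\gamma^*\eta=\psi$. For $\psi\in S(W)$ and $V\in\mathcal V^f$ let $\psi\boxplus\epsilon_V\in S(W\oplus V)$ be the pullback of $\psi$ along the projection $W\oplus V\to W$. Let $\mathcal F(\mathfrak S_S,\mathcal V)$ be the category of functors $\mathfrak S_S\to\mathcal V$.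 For such a functor $F$, let $\bar\Delta F(W,\psi)$ be the kernel of the map $F(W\oplus\mathbb F_p,\psi\boxplus\epsilon_{\mathbb F_p})\to F(W,\psi)$ induced by the projection, with $\bar\Delta F(\alpha)$ induced by $\alpha\oplus\mathrm{id}$. The functor $F$ is polynomial of degree at most $n$ if $\bar\Delta^{n+1}F=0$, and polynomial if this holds for some $n\ge 0$. Let $p_n(F)$ be the greatest subfunctor of $F$ that is polynomial of degree at most $n$; $F$ is analytic if it is the colimit of $p_0(F)\subset p_1(F)\subset\cdots$. Then: 1. For every $(W,\psi)\in\mathfrak S_S$ with $\psi$ regular and every $V\in\mathcal V^f$, the functor $I_{(W\oplus V,\psi\boxplus\epsilon_V)}=\mathbb F_p^{\mathrm{Hom}_{\mathfrak S_S}(-,(W\oplus V,\psi\boxplus\epsilon_V))}$ is an injective object of $\mathcal F(\mathfrak S_S,\mathcal V)$ and is analytic. 2. The functors $I_{(W\oplus V,\psi\boxplus\epsilon_V)}$, with $\psi$ regular, form a family of cogenerators of $\mathcal F(\mathfrak S_S,\mathcal V)$. 3. Every simple object of $\mathcal F(\mathfrak S_S,\mathcal V)$ is polynomial. -/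

import Mathlib

open CategoryTheory Limits Opposite

universe u w

noncomputable section

namespace PolyElem

/-- Contravariant set-valued functors on finite dimensional `k`-vector spaces. -/
abbrev VPresheaf (k : Type) [Field k] := (FGModuleCat.{u} k)ᵒᵖ ⥤ Type w

section Kernel

variable {k : Type} [Field k] (S : VPresheaf.{u, w} k)

/-- The pullback `α^* t ∈ S(V)` of `t ∈ S(W)` along a linear map `α : V → W`. -/
def pull {V W : FGModuleCat.{u} k} (α : V →ₗ[k] W) (t : S.obj (op W)) : S.obj (op V) :=
  S.map (FGModuleCat.ofHom α).op t

theorem pull_id {V : FGModuleCat.{u} k} (t : S.obj (op V)) :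
    pull S (LinearMap.id : V →ₗ[k] V) t = t := by
  have h : (FGModuleCat.ofHom (LinearMap.id : V →ₗ[k] V)) = 𝟙 V := rfl
  unfold pull
  rw [h]
  simp

theorem pull_pull {U V W : FGModuleCat.{u} k} (α : U →ₗ[k] V) (β : V →ₗ[k] W)
    (t : S.obj (op W)) : pull S α (pull S β t) = pull S (β ∘ₗ α) t := by
  have h : (FGModuleCat.ofHom (β ∘ₗ α) : U ⟶ W) =
      FGModuleCat.ofHom α ≫ FGModuleCat.ofHom β := rfl
  unfold pull
  rw [h]
  simp

/-- The kernel of `s ∈ S(V)`: the largest subspace of `V` of the form `ker α` for a linear map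
`α : V → W` such that `s = α^* t` for some `t ∈ S(W)`. -/
def ker {V : FGModuleCat.{u} k} (s : S.obj (op V)) : Submodule k V :=
  sSup {U | ∃ (W : FGModuleCat.{u} k) (α : V →ₗ[k] W) (t : S.obj (op W)),
    s = pull S α t ∧ LinearMap.ker α = U}

theorem exists_eq_pull_mkQ {V : FGModuleCat.{u} k} {s : S.obj (op V)} {U : Submodule k V}
    (h : ∃ (W : FGModuleCat.{u} k) (α : V →ₗ[k] W) (t : S.obj (op W)),
      s = pull S α t ∧ U ≤ LinearMap.ker α) :
    ∃ t : S.obj (op (FGModuleCat.of k (V ⧸ U))),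
      s = pull S (W := FGModuleCat.of k (V ⧸ U)) U.mkQ t := by
  obtain ⟨W, α, t, hs, hU⟩ := h
  refine ⟨pull S (V := FGModuleCat.of k (V ⧸ U)) (U.liftQ α hU) t, ?_⟩
  rw [pull_pull, hs]
  congr 1

/-- The supremum defining `ker s` is attained: `s` comes from the quotient `V / ker s`. -/
theorem exists_eq_pull_mkQ_ker {V : FGModuleCat.{u} k} (s : S.obj (op V)) :
    ∃ t : S.obj (op (FGModuleCat.of k (V ⧸ ker S s))),
      s = pull S (W := FGModuleCat.of k (V ⧸ ker S s)) (ker S s).mkQ t := by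
  have key : ker S s ∈ {U | ∃ (W : FGModuleCat.{u} k) (α : V →ₗ[k] W) (t : S.obj (op W)),
      s = pull S α t ∧ LinearMap.ker α = U} := by
    have : WellFoundedGT (Submodule k V) := inferInstance
    refine (CompleteLattice.isSupClosedCompact_iff_wellFoundedGT (Submodule k V)).2 this _
      ⟨⊥, V, LinearMap.id, s, (pull_id S s).symm, LinearMap.ker_id⟩ ?_
    rintro U₁ ⟨W₁, α₁, t₁, h₁, rfl⟩ U₂ ⟨W₂, α₂, t₂, h₂, rfl⟩
    set U₁ := LinearMap.ker α₁ with hU₁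
    set U₂ := LinearMap.ker α₂ with hU₂
    obtain ⟨E, hE⟩ := exists_isCompl (U₁ ⊓ U₂)
    have hD : Disjoint (E ⊓ U₂) U₁ := by
      rw [disjoint_iff, eq_bot_iff]
      intro x hx
      have : x ∈ (U₁ ⊓ U₂) ⊓ E := ⟨⟨hx.2, hx.1.2⟩, hx.1.1⟩
      rwa [hE.inf_eq_bot] at this
    obtain ⟨C, hDC, hC⟩ := hD.exists_isCompl
    obtain ⟨C₂, hC₂'⟩ := exists_isCompl U₂
    have hC₂ := hC₂'.symm
    have aux : ∀ (W : FGModuleCat.{u} k) (α : V →ₗ[k] W) (t : S.obj (op W)) (C : Submodule k V)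
        (hC : IsCompl C (LinearMap.ker α)), s = pull S α t → pull S (C.projection _ hC) s = s := by
      intro W α t C hC hs
      rw [hs, pull_pull]
      congr 1
      ext x
      obtain ⟨c, hc, a, ha, rfl⟩ := Submodule.mem_sup.1 (hC.sup_eq_top.ge (Submodule.mem_top (x := x)))
      rw [LinearMap.comp_apply, map_add (C.projection _ hC),
        Submodule.projection_apply_of_mem_left hC hc, Submodule.projection_apply_of_mem_right hC ha,
        map_add, map_add, LinearMap.mem_ker.1 ha, map_zero]
    have e₁ := aux _ _ _ _ hC h₁
    have e₂ := aux _ _ _ _ hC₂ h₂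
    obtain ⟨t, ht⟩ := exists_eq_pull_mkQ S (s := s) (U := U₁ ⊔ U₂)
      ⟨V, C₂.projection _ hC₂ ∘ₗ C.projection _ hC, s, by rw [← pull_pull, e₂, e₁], by
        refine sup_le (fun x hx => ?_) (fun x hx => ?_)
        · rw [LinearMap.mem_ker, LinearMap.comp_apply,
            Submodule.projection_apply_of_mem_right hC hx, map_zero]
        · obtain ⟨a, ha, d, hd, rfl⟩ :=
            Submodule.mem_sup.1 (hE.sup_eq_top.ge (Submodule.mem_top (x := x)))
          have hd₂ : d ∈ U₂ := by simpa using U₂.sub_mem hx ha.2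
          rw [LinearMap.mem_ker, LinearMap.comp_apply, map_add (C.projection _ hC),
            Submodule.projection_apply_of_mem_right hC ha.1,
            Submodule.projection_apply_of_mem_left hC (hDC ⟨hd, hd₂⟩), zero_add,
            Submodule.projection_apply_of_mem_right hC₂ hd₂]⟩
    exact ⟨_, _, t, ht, Submodule.ker_mkQ _⟩
  obtain ⟨W, α, t, hs, hα⟩ := key
  exact exists_eq_pull_mkQ S ⟨W, α, t, hs, hα.ge⟩

/-- `s` is regular if its kernel is zero. -/
def IsRegular {V : FGModuleCat.{u} k} (s : S.obj (op V)) : Prop := ker S s = ⊥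

/-- The weaker noetherianity condition: `ker (α^* s) = α⁻¹ (ker s)`. -/
def WeaklyNoetherian : Prop :=
  ∀ ⦃U V : FGModuleCat.{u} k⦄ (α : U →ₗ[k] V) (s : S.obj (op V)),
    ker S (pull S α s) = (ker S s).comap α

/-- `ψ ⊞ ε_V ∈ S(W ⊕ V)`: the pullback of `ψ ∈ S(W)` along the projection `W ⊕ V → W`. -/
def box {W : FGModuleCat.{u} k} (ψ : S.obj (op W)) (V : FGModuleCat.{u} k) :
    S.obj (op (FGModuleCat.of k (W × V))) :=
  pull S (V := FGModuleCat.of k (W × V)) (LinearMap.fst k W V) ψ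


/-- For weakly noetherian `S`, `ψ ⊞ ε_V` is the only element of `S(W ⊕ V)` that restricts to `ψ` on
`W` and, on `V`, to the element induced from `S(0)` (which is `ε_V` if `S(0) = {ε}`). -/
theorem eq_box_iff (hS : WeaklyNoetherian S) {W V : FGModuleCat.{u} k} (ψ : S.obj (op W))
    (γ : S.obj (op (FGModuleCat.of k (W × V)))) :
    γ = box S ψ V ↔
      pull S (W := FGModuleCat.of k (W × V)) (LinearMap.inl k W V) γ = ψ ∧
      ∃ ε : S.obj (op (FGModuleCat.of k PUnit)),
        pull S (W := FGModuleCat.of k (W × V)) (LinearMap.inr k W V) γ =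
          pull S (W := FGModuleCat.of k PUnit) 0 ε := by
  constructor
  · rintro rfl
    refine ⟨?_, pull S (V := FGModuleCat.of k PUnit) 0 ψ, ?_⟩
    · rw [box, pull_pull]
      exact pull_id S ψ
    · rw [box, pull_pull, pull_pull]
      congr 1
  · rintro ⟨h₁, ε, h₂⟩
    have h₃ := hS (V := FGModuleCat.of k (W × V)) (LinearMap.inr k W V) γ
    have h₄ : ker S (pull S (V := V) (W := FGModuleCat.of k PUnit) 0 ε) = ⊤ :=
      top_le_iff.1 (le_sSup ⟨_, _, ε, rfl, LinearMap.ker_zero⟩)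
    rw [h₂, h₄] at h₃
    obtain ⟨t, ht⟩ := exists_eq_pull_mkQ_ker S γ
    have h₅ : γ = pull S (V := FGModuleCat.of k (W × V)) (LinearMap.inl k W V ∘ₗ
        LinearMap.fst k W V : W × V →ₗ[k] W × V) γ := by
      conv_lhs => rw [ht]
      conv_rhs => rw [ht]
      rw [pull_pull]
      congr 1
      apply LinearMap.ext
      rintro ⟨x, y⟩
      have hy : (0, y) ∈ ker S γ := (h₃.le (Submodule.mem_top (x := y)) : _)
      refine (Submodule.Quotient.eq _).2 ?_
      simpa using hy
    rw [box, ← h₁, pull_pull]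
    exact h₅

end Kernel

section Elements

variable {k : Type} [Field k]

/-- The category of elements `𝔖_S`: its objects are the pairs `(W, ψ)` with `ψ ∈ S(W)`, its
morphisms `(W, ψ) ⟶ (H, η)` the linear maps `γ : W → H` with `γ^* η = ψ`. -/
abbrev Elem (S : VPresheaf.{u, w} k) := S.Elementsᵒᵖ

variable (S : VPresheaf.{u, w} k)

/-- The object `(W, ψ)` of `𝔖_S`. -/
abbrev Elem.mk (W : FGModuleCat.{u} k) (ψ : S.obj (op W)) : Elem S :=
  op (S.elementsMk (op W) ψ)

variable {S}

/-- The vector space `W` of `(W, ψ)`. -/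
abbrev Elem.space (X : Elem S) : FGModuleCat.{u} k := X.unop.1.unop

/-- The element `ψ` of `(W, ψ)`. -/
abbrev Elem.elt (X : Elem S) : S.obj (op X.space) := X.unop.2

/-- The linear map underlying a morphism of `𝔖_S`. -/
abbrev Elem.lin {X Y : Elem S} (f : X ⟶ Y) : X.space →ₗ[k] Y.space := f.unop.val.unop.hom.hom

theorem Elem.pull_lin {X Y : Elem S} (f : X ⟶ Y) : pull S (Elem.lin f) Y.elt = X.elt :=
  f.unop.property

/-- A linear map `γ` with `γ^* η = ψ`, as a morphism `(W, ψ) ⟶ (H, η)` of `𝔖_S`. -/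
def Elem.homMk {X Y : Elem S} (γ : X.space →ₗ[k] Y.space) (h : pull S γ Y.elt = X.elt) : X ⟶ Y :=
  Quiver.Hom.op (CategoryOfElements.homMk Y.unop X.unop (FGModuleCat.ofHom γ).op h)

/-- The base field as a one-dimensional vector space in the ambient universe. -/
abbrev line (k : Type) [Field k] : FGModuleCat.{u} k := FGModuleCat.of k (ULift.{u} k)

/-- The object `(W ⊕ V, ψ ⊞ ε_V)`. -/
abbrev Elem.boxObj (X : Elem S) (V : FGModuleCat.{u} k) : Elem S :=
  Elem.mk S (FGModuleCat.of k (X.space × V)) (box S X.elt V)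

/-- The projection `(W ⊕ V, ψ ⊞ ε_V) ⟶ (W, ψ)`. -/
def Elem.proj (X : Elem S) (V : FGModuleCat.{u} k) : X.boxObj V ⟶ X :=
  Elem.homMk (LinearMap.fst k X.space V) rfl

/-- The morphism `α ⊕ id_V : (W ⊕ V, ψ ⊞ ε_V) ⟶ (H ⊕ V, η ⊞ ε_V)`. -/
def Elem.boxMap {X Y : Elem S} (α : X ⟶ Y) (V : FGModuleCat.{u} k) : X.boxObj V ⟶ Y.boxObj V :=
  Elem.homMk (LinearMap.prodMap (Elem.lin α) LinearMap.id) (by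
    change pull S _ (pull S _ _) = pull S _ _
    rw [pull_pull, ← Elem.pull_lin α, pull_pull]
    rfl)

theorem Elem.hom_ext {X Y : Elem S} {f g : X ⟶ Y} (h : Elem.lin f = Elem.lin g) : f = g :=
  Quiver.Hom.unop_inj (CategoryOfElements.ext _ _ _ (Quiver.Hom.unop_inj (FGModuleCat.hom_ext h)))

theorem Elem.boxMap_proj {X Y : Elem S} (α : X ⟶ Y) (V : FGModuleCat.{u} k) :
    Elem.boxMap α V ≫ Y.proj V = X.proj V ≫ α := Elem.hom_ext rfl

theorem Elem.boxMap_id (X : Elem S) (V : FGModuleCat.{u} k) : Elem.boxMap (𝟙 X) V = 𝟙 _ :=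
  Elem.hom_ext rfl

theorem Elem.boxMap_comp {X Y Z : Elem S} (α : X ⟶ Y) (β : Y ⟶ Z) (V : FGModuleCat.{u} k) :
    Elem.boxMap (α ≫ β) V = Elem.boxMap α V ≫ Elem.boxMap β V := Elem.hom_ext rfl

end Elements

section Polynomial

variable {k : Type} [Field k] {S : VPresheaf.{u, w} k}

/-- The category `𝓕(𝔖_S, 𝓥)` of functors from `𝔖_S` to `k`-vector spaces. -/
abbrev FunctorCat (S : VPresheaf.{u, w} k) := Elem S ⥤ ModuleCat.{u} k

/-- The difference functor: `Δ F (W, ψ)` is the kernel of the map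
`F(W ⊕ k, ψ ⊞ ε_k) → F(W, ψ)` induced by the projection, and `Δ F α` is induced by `α ⊕ id_k`. -/
def Delta (F : FunctorCat S) : FunctorCat S where
  obj X := ModuleCat.of k (LinearMap.ker (F.map (X.proj (line k))).hom)
  map {X Y} α := ModuleCat.ofHom ((F.map (Elem.boxMap α (line k))).hom.restrict (by
    intro x hx
    have h := congrArg (fun f => (F.map f).hom x) (Elem.boxMap_proj α (line k))
    simp only [F.map_comp, ModuleCat.hom_comp, LinearMap.comp_apply] at h
    rw [LinearMap.mem_ker] at hx ⊢
    rw [h, hx, map_zero]))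
  map_id X := by
    ext x
    simp [Elem.boxMap_id]
  map_comp α β := by
    ext x
    simp [Elem.boxMap_comp]

/-- The action of the difference functor on natural transformations. -/
def DeltaMap {F G : FunctorCat S} (φ : F ⟶ G) : Delta F ⟶ Delta G where
  app X := ModuleCat.ofHom ((φ.app (X.boxObj (line k))).hom.restrict (by
    intro x hx
    have h := congrArg (fun f => f.hom x) (φ.naturality (X.proj (line k)))
    simp only [ModuleCat.hom_comp, LinearMap.comp_apply] at h
    rw [LinearMap.mem_ker] at hx ⊢
    rw [← h, hx, map_zero]))
  naturality X Y α := by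
    ext x
    have h := congrArg (fun f => f.hom x.1) (φ.naturality (Elem.boxMap α (line k)))
    simp only [ModuleCat.hom_comp, LinearMap.comp_apply] at h
    exact Subtype.ext h

/-- `F` is polynomial of degree at most `n`: `Δ^{n+1} F = 0`. -/
def IsPolyOfDegreeLE (n : ℕ) (F : FunctorCat S) : Prop := IsZero (Delta^[n + 1] F)

/-- `F` is polynomial (of some degree). -/
def IsPoly (F : FunctorCat S) : Prop := ∃ n, IsPolyOfDegreeLE n F

theorem Delta_isZero {F : FunctorCat S} (hF : IsZero F) : IsZero (Delta F) := by
  rw [Functor.isZero_iff] at hF ⊢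
  intro X
  have := ModuleCat.subsingleton_of_isZero (hF (X.boxObj (line k)))
  have : Subsingleton ((Delta F).obj X) := Subtype.coe_injective.subsingleton
  exact ModuleCat.isZero_of_subsingleton _

theorem IsPolyOfDegreeLE.mono {F : FunctorCat S} {m n : ℕ} (hmn : m ≤ n)
    (h : IsPolyOfDegreeLE m F) : IsPolyOfDegreeLE n F := by
  induction n, hmn using Nat.le_induction with
  | base => exact h
  | succ n _ ih =>
    unfold IsPolyOfDegreeLE at ih ⊢
    rw [Function.iterate_succ_apply']
    exact Delta_isZero ih

/-- The inclusion `(W, ψ) ⟶ (W ⊕ V, ψ ⊞ ε_V)`, a section of the projection. -/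
def Elem.incl (X : Elem S) (V : FGModuleCat.{u} k) : X ⟶ X.boxObj V :=
  Elem.homMk (LinearMap.inl k X.space V) ((pull_pull S _ _ _).trans (pull_id S _))

theorem Elem.incl_proj (X : Elem S) (V : FGModuleCat.{u} k) : X.incl V ≫ X.proj V = 𝟙 X :=
  Elem.hom_ext rfl

theorem Delta_iSup_range {ι : Type*} {G : ι → FunctorCat S} {H : FunctorCat S}
    (φ : ∀ i, G i ⟶ H) (h : ∀ X, ⨆ i, LinearMap.range ((φ i).app X).hom = ⊤) (X : Elem S) :
    ⨆ i, LinearMap.range ((DeltaMap (φ i)).app X).hom = ⊤ := by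
  have key : ∀ K : FunctorCat S, ∀ y : K.obj (X.boxObj (line k)),
      (K.map (X.proj (line k))).hom
        (y - (K.map (X.incl (line k))).hom ((K.map (X.proj (line k))).hom y)) = 0 := by
    intro K y
    have := congrArg (fun f => (K.map f).hom ((K.map (X.proj (line k))).hom y))
      (X.incl_proj (line k))
    simp only [K.map_comp, K.map_id, ModuleCat.hom_comp, LinearMap.comp_apply,
      ModuleCat.hom_id, LinearMap.id_apply] at this
    rw [map_sub, this, sub_self]
  let r : H.obj (X.boxObj (line k)) →ₗ[k] LinearMap.ker (H.map (X.proj (line k))).hom :=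
    LinearMap.codRestrict _
      (LinearMap.id - (H.map (X.incl (line k))).hom ∘ₗ (H.map (X.proj (line k))).hom) (key H)
  have hr : ∀ x : LinearMap.ker (H.map (X.proj (line k))).hom, r x.1 = x := by
    intro x
    apply Subtype.ext
    change x.1 - (H.map (X.incl (line k))).hom ((H.map (X.proj (line k))).hom x.1) = x.1
    rw [LinearMap.mem_ker.1 x.2, map_zero, sub_zero]
  rw [eq_top_iff]
  intro x _
  have hx : r x.1 ∈ Submodule.map r (⨆ i, LinearMap.range ((φ i).app (X.boxObj (line k))).hom) := by
    rw [h]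
    exact ⟨_, Submodule.mem_top, rfl⟩
  rw [hr x, Submodule.map_iSup] at hx
  refine (iSup_mono (fun i => ?_) :
    (⨆ i, Submodule.map r (LinearMap.range ((φ i).app (X.boxObj (line k))).hom)) ≤ _) hx
  rintro _ ⟨_, ⟨y, rfl⟩, rfl⟩
  refine ⟨⟨_, key (G i) y⟩, Subtype.ext ?_⟩
  have h₁ := congrArg (fun f => f.hom y) ((φ i).naturality (X.proj (line k)))
  have h₂ := congrArg (fun f => f.hom (((G i).map (X.proj (line k))).hom y))
    ((φ i).naturality (X.incl (line k)))
  simp only [ModuleCat.hom_comp, LinearMap.comp_apply] at h₁ h₂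
  change ((φ i).app _).hom (y - _) = ((φ i).app _).hom y - _
  rw [map_sub, h₂, h₁]
  rfl

theorem Delta_iterate_isZero {ι : Type*} (m : ℕ) {G : ι → FunctorCat S} {H : FunctorCat S}
    (φ : ∀ i, G i ⟶ H) (h : ∀ X, ⨆ i, LinearMap.range ((φ i).app X).hom = ⊤)
    (hG : ∀ i, IsZero (Delta^[m] (G i))) : IsZero (Delta^[m] H) := by
  induction m generalizing G H with
  | zero =>
    rw [Functor.isZero_iff]
    intro X
    have : ∀ x : H.obj X, x = 0 := by
      intro x
      have hx : x ∈ ⨆ i, LinearMap.range ((φ i).app X).hom := by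
        rw [h]
        exact Submodule.mem_top
      rw [show (⨆ i, LinearMap.range ((φ i).app X).hom) = ⊥ from ?_] at hx
      · simpa using hx
      · rw [iSup_eq_bot]
        intro i
        have : Subsingleton ((G i).obj X) :=
          ModuleCat.subsingleton_of_isZero ((Functor.isZero_iff _).1 (hG i) X)
        rw [eq_bot_iff]
        rintro _ ⟨y, rfl⟩
        rw [Submodule.mem_bot]
        exact (congrArg _ (Subsingleton.elim (α := (G i).obj X) y 0)).trans (map_zero _)
    have : Subsingleton (H.obj X) := ⟨fun x y => (this x).trans (this y).symm⟩
    exact ModuleCat.isZero_of_subsingleton (H.obj X)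
  | succ m ih =>
    simp only [Function.iterate_succ_apply] at hG ⊢
    exact ih (fun i => DeltaMap (φ i)) (Delta_iSup_range φ h) hG

/-- A subfunctor of `F`: a family of subspaces of the `F(W, ψ)` stable under all morphisms. -/
@[ext]
structure SubFunctor (F : FunctorCat S) where
  obj : ∀ X : Elem S, Submodule k (F.obj X)
  le_comap : ∀ ⦃X Y : Elem S⦄ (f : X ⟶ Y), obj X ≤ (obj Y).comap (F.map f).hom

namespace SubFunctor

variable {F : FunctorCat S}

instance : PartialOrder (SubFunctor F) :=
  PartialOrder.lift SubFunctor.obj (fun _ _ h => SubFunctor.ext h)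

/-- A subfunctor as a functor. -/
def toFunctor (G : SubFunctor F) : FunctorCat S where
  obj X := ModuleCat.of k (G.obj X)
  map {X Y} f := ModuleCat.ofHom ((F.map f).hom.restrict (G.le_comap f))
  map_id X := by
    ext x
    simp
  map_comp f g := by
    ext x
    simp

/-- The inclusion of a subfunctor. -/
def incl (G : SubFunctor F) : G.toFunctor ⟶ F where
  app X := ModuleCat.ofHom (G.obj X).subtype
  naturality _ _ _ := rfl

/-- The inclusion between two comparable subfunctors. -/
def homOfLE {G H : SubFunctor F} (h : G ≤ H) : G.toFunctor ⟶ H.toFunctor where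
  app X := ModuleCat.ofHom (Submodule.inclusion (h X))
  naturality _ _ _ := rfl

/-- The functor from the ordered set of subfunctors of `F` to `𝓕(𝔖_S, 𝓥)`. -/
def forget (F : FunctorCat S) : SubFunctor F ⥤ FunctorCat S where
  obj G := G.toFunctor
  map h := homOfLE (leOfHom h)
  map_id _ := rfl
  map_comp _ _ := rfl

end SubFunctor

/-- `p_n(F)`, the greatest polynomial subfunctor of degree at most `n`: the sum of all polynomial
subfunctors of degree at most `n`. -/
def polyPart (F : FunctorCat S) (n : ℕ) : SubFunctor F where
  obj X := ⨆ G : {G : SubFunctor F // IsPolyOfDegreeLE n G.toFunctor}, G.1.obj X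
  le_comap X Y f := iSup_le fun G => (G.1.le_comap f).trans
    (Submodule.comap_mono (le_iSup (fun G : {G : SubFunctor F //
      IsPolyOfDegreeLE n G.toFunctor} => G.1.obj Y) G))

theorem polyPart_mono (F : FunctorCat S) : Monotone (polyPart F) := fun _ _ hmn _ =>
  iSup_le fun G => le_iSup (fun G : {G : SubFunctor F // IsPolyOfDegreeLE _ G.toFunctor} =>
    G.1.obj _) ⟨G.1, G.2.mono hmn⟩

theorem iSup_range_inclusion {M : Type*} [AddCommGroup M] [Module k M] {ι : Type*}
    (N : ι → Submodule k M) (Q : Submodule k M) (h : ∀ i, N i ≤ Q) (hQ : Q = ⨆ i, N i) :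
    ⨆ i, LinearMap.range (Submodule.inclusion (h i)) = ⊤ := by
  apply Submodule.map_injective_of_injective (f := Q.subtype) Subtype.coe_injective
  rw [Submodule.map_iSup, Submodule.map_top, Submodule.range_subtype]
  conv_rhs => rw [hQ]
  refine iSup_congr fun i => ?_
  rw [Submodule.range_inclusion, Submodule.map_comap_subtype]
  exact inf_eq_right.2 (h i)

theorem isGreatest_polyPart (F : FunctorCat S) (n : ℕ) :
    IsGreatest {G : SubFunctor F | IsPolyOfDegreeLE n G.toFunctor} (polyPart F n) := by
  have le : ∀ G : {G : SubFunctor F // IsPolyOfDegreeLE n G.toFunctor}, G.1 ≤ polyPart F n :=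
    fun G _ => le_iSup (fun G : {G : SubFunctor F // IsPolyOfDegreeLE n G.toFunctor} =>
      G.1.obj _) G
  refine ⟨?_, fun G hG => le ⟨G, hG⟩⟩
  refine Delta_iterate_isZero (n + 1) (fun G => SubFunctor.homOfLE (le G)) (fun X => ?_)
    (fun G => G.2)
  exact iSup_range_inclusion (fun G : {G : SubFunctor F // IsPolyOfDegreeLE n G.toFunctor} =>
    G.1.obj X) _ (fun G => le G X) rfl

/-- The sequence `p_0(F) ⟶ p_1(F) ⟶ p_2(F) ⟶ ⋯`. -/
def polyFiltration (F : FunctorCat S) : ℕ ⥤ FunctorCat S :=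
  (polyPart_mono F).functor ⋙ SubFunctor.forget F

/-- The inclusions `p_n(F) ⟶ F`, as a cocone over the sequence of the `p_n(F)`. -/
def polyCocone (F : FunctorCat S) : Cocone (polyFiltration F) where
  pt := F
  ι :=
    { app := fun n => (polyPart F n).incl
      naturality := fun _ _ _ => rfl }

/-- `F` is analytic if it is the colimit of the `p_n(F)`. -/
def IsAnalytic (F : FunctorCat S) : Prop := Nonempty (IsColimit (polyCocone F))

/-- The functor `I_X = k^{Hom(-, X)}`. -/
def coRep (X : Elem S) : FunctorCat S where
  obj Y := ModuleCat.of k ((Y ⟶ X) → k)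
  map f := ModuleCat.ofHom (LinearMap.funLeft k k (fun g => f ≫ g))
  map_id Y := by
    ext φ
    simp [LinearMap.funLeft_apply]
  map_comp f g := by
    ext φ
    simp [LinearMap.funLeft_apply]

/-- The family of the functors `I_{(W ⊕ V, ψ ⊞ ε_V)}` with `ψ` regular. -/
inductive IsStandardInjective (S : VPresheaf.{u, w} k) : FunctorCat S → Prop
  | intro (W : FGModuleCat.{u} k) (ψ : S.obj (op W)) (hψ : IsRegular S ψ) (V : FGModuleCat.{u} k) :
      IsStandardInjective S (coRep ((Elem.mk S W ψ).boxObj V))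

end Polynomial

end PolyElem

end

/-!
By a Yoneda argument the maps `F ⟶ I_X` are the linear forms on `F(X)`, so `I_X` is injective and
every nonzero `x ∈ F(X)` is detected by a map to `I_X`. Splitting off `ker s` shows that each object
`(U, s)` is isomorphic to some `(W ⊕ V, ψ ⊞ ε_V)` with `ψ` regular; hence the cogeneration.

`Hom(Y, V)` acts by translations on the morphisms `Y ⟶ (W ⊕ V, ψ ⊞ ε_V)`. If `ψ` is regular, a
morphism `Y ⊕ L ⟶ (W, ψ)` vanishes on `L` by weak noetherianity, so a morphism
`Y ⊕ L ⟶ (W ⊕ V, ψ ⊞ ε_V)` is a translate, by a linear map `L → V`, of one that factors through `Y`.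
Therefore `Δ` lowers the degree of functions with respect to translations. Over a finite field of
characteristic `p`, `Hom(Y, V)` is a finite `p`-group, the augmentation ideal of its group algebra
is nilpotent, and every function on `Hom(Y, (W ⊕ V, ψ ⊞ ε_V))` has finite degree: this is
analyticity.
Finally, a simple functor embeds into one of these analytic functors and meets, hence lies in, some
`p_n` of it.
-/

noncomputable section

namespace PolyElem

section Differences

variable (A M k : Type*) [CommRing k]

/-- The difference operator `f ↦ f (a + ·) - f` on the functions on a set `M` on which the additive
monoid `A` acts by translations. -/
def difference {A M} [VAdd A M] (a : A) : Module.End k (M → k) :=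
  LinearMap.funLeft k k (a +ᵥ ·) - 1

/-- The functions on `M` of degree less than `n`: those annihilated by all `n`-fold differences with
directions in `A`. Starting from degree less than `0`, i.e. from `0`, avoids a separate treatment of
constant functions. -/
def degreeLT [VAdd A M] : ℕ → Submodule k (M → k)
  | 0 => ⊥
  | n + 1 => ⨅ a : A, (degreeLT n).comap (difference k a)

variable {A M k}

theorem mem_degreeLT_succ [VAdd A M] {n : ℕ} {f : M → k} :
    f ∈ degreeLT A M k (n + 1) ↔ ∀ a : A, difference k a f ∈ degreeLT A M k n := by
  simp only [degreeLT, Submodule.mem_iInf, Submodule.mem_comap]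

theorem comp_mem_degreeLT {B N : Type*} [VAdd A M] [VAdd B N] (τ : B → A) (u : N → M)
    (hu : ∀ b x, u (b +ᵥ x) = τ b +ᵥ u x) {n : ℕ} {f : M → k} (hf : f ∈ degreeLT A M k n) :
    f ∘ u ∈ degreeLT B N k n := by
  induction n generalizing f with
  | zero =>
    obtain rfl : f = 0 := hf
    exact Submodule.zero_mem _
  | succ n ih =>
    refine mem_degreeLT_succ.2 fun b => ?_
    have hcomm : difference k b (f ∘ u) = difference k (τ b) f ∘ u := by
      funext x
      exact congrArg (fun y => f y - f (u x)) (hu b x)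
    rw [hcomm]
    exact ih (mem_degreeLT_succ.1 hf (τ b))

variable (A M k) in
/-- The action of the group algebra `k[A]` on the functions on `M` by translations. -/
def translation [AddCommMonoid A] [AddAction A M] :
    AddMonoidAlgebra k A →ₐ[k] Module.End k (M → k) :=
  AddMonoidAlgebra.lift k (Module.End k (M → k)) A
    { toFun := fun a => LinearMap.funLeft k k (a.toAdd +ᵥ ·)
      map_one' := by
        ext1 f
        funext x
        exact congrArg f (zero_vadd A x)
      map_mul' := fun a b => by
        ext1 f
        funext x
        change f ((a.toAdd + b.toAdd) +ᵥ x) = f (b.toAdd +ᵥ a.toAdd +ᵥ x)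
        rw [add_comm, add_vadd] }

theorem translation_single_sub_one [AddCommMonoid A] [AddAction A M] (a : A) :
    translation A M k (AddMonoidAlgebra.single a 1 - 1) = difference k a := by
  rw [map_sub, map_one, translation, AddMonoidAlgebra.lift_single, one_smul]
  rfl

variable (A k) in
/-- The augmentation ideal of the group algebra `k[A]`, given by its standard generators. -/
def augmentationIdeal [AddCommMonoid A] : Ideal (AddMonoidAlgebra k A) :=
  Ideal.span (Set.range fun a : A => AddMonoidAlgebra.single a 1 - 1)

theorem mem_degreeLT_of_augmentationIdeal_pow [AddCommMonoid A] [AddAction A M] {n : ℕ}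
    {f : M → k} (hf : ∀ r ∈ augmentationIdeal A k ^ n, translation A M k r f = 0) :
    f ∈ degreeLT A M k n := by
  induction n generalizing f with
  | zero =>
    have h := hf 1 (by rw [pow_zero, Ideal.one_eq_top]; exact Submodule.mem_top)
    rwa [map_one] at h
  | succ n ih =>
    refine mem_degreeLT_succ.2 fun a => ih fun r hr => ?_
    rw [← translation_single_sub_one, ← Module.End.mul_apply, ← map_mul]
    exact hf _ (Ideal.mul_mem_mul hr (Ideal.subset_span ⟨a, rfl⟩))

variable (p : ℕ) [Fact p.Prime] [CharP k p] [AddCommMonoid A] [Finite A]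

theorem isNilpotent_augmentationIdeal (hA : ∀ a : A, ∃ m : ℕ, p ^ m • a = 0) :
    IsNilpotent (augmentationIdeal A k) := by
  have hfg : (augmentationIdeal A k).FG := Submodule.fg_span (Set.finite_range _)
  rw [hfg.isNilpotent_iff_le_nilradical, augmentationIdeal, Ideal.span_le]
  rintro _ ⟨a, rfl⟩
  obtain ⟨m, hm⟩ := hA a
  have : CharP (AddMonoidAlgebra k A) p :=
    charP_of_injective_algebraMap' k p
  refine ⟨p ^ m, ?_⟩
  rw [sub_pow_char_pow, AddMonoidAlgebra.single_pow, hm, one_pow, one_pow]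
  exact sub_self _

theorem exists_degreeLT_eq_top [AddAction A M] (hA : ∀ a : A, ∃ m : ℕ, p ^ m • a = 0) :
    ∃ n, degreeLT A M k n = ⊤ := by
  obtain ⟨n, hn⟩ := isNilpotent_augmentationIdeal (k := k) p hA
  refine ⟨n, eq_top_iff.2 fun f _ => mem_degreeLT_of_augmentationIdeal_pow fun r hr => ?_⟩
  obtain rfl : r = 0 := by rwa [hn] at hr
  rw [map_zero, LinearMap.zero_apply]

end Differences

section FunctorCat

variable {k : Type} [Field k] {S : VPresheaf.{u, w} k} {F G : FunctorCat S}

theorem isZero_iff_forall_eq_zero : IsZero F ↔ ∀ X (x : F.obj X), x = 0 := by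
  rw [Functor.isZero_iff]
  refine forall_congr' fun X => ?_
  rw [ModuleCat.isZero_iff_subsingleton, subsingleton_iff_forall_eq 0]

theorem app_injective_of_mono (φ : F ⟶ G) [Mono φ] (X : Elem S) :
    Function.Injective (φ.app X).hom :=
  (ModuleCat.mono_iff_injective _).1 inferInstance

theorem isZero_Delta_iterate_of_jointly_injective {ι : Type*} {G : ι → FunctorCat S}
    (φ : ∀ i, F ⟶ G i)
    (hφ : ∀ X (x : F.obj X), (∀ i, ((φ i).app X).hom x = 0) → x = 0) {m : ℕ}
    (hG : ∀ i, IsZero (Delta^[m] (G i))) : IsZero (Delta^[m] F) := by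
  induction m generalizing F G with
  | zero =>
    exact isZero_iff_forall_eq_zero.2 fun X x =>
      hφ X x fun i => isZero_iff_forall_eq_zero.1 (hG i) X _
  | succ m ih =>
    rw [Function.iterate_succ_apply]
    exact ih (fun i => DeltaMap (φ i))
      (fun X x hx => Subtype.ext (hφ _ x.1 fun i => congrArg Subtype.val (hx i))) hG

theorem IsPolyOfDegreeLE.of_mono {n : ℕ} (hG : IsPolyOfDegreeLE n G) (φ : F ⟶ G) [Mono φ] :
    IsPolyOfDegreeLE n F :=
  isZero_Delta_iterate_of_jointly_injective (fun _ : Unit => φ)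
    (fun X _ hx => (map_eq_zero_iff _ (app_injective_of_mono φ X)).1 (hx ())) fun _ => hG

namespace SubFunctor

instance mono_incl (Q : SubFunctor F) : Mono Q.incl :=
  (NatTrans.mono_iff_mono_app _).2 fun _ =>
    (ModuleCat.mono_iff_injective _).2 Subtype.coe_injective

/-- The preimage of a subfunctor under a natural transformation. -/
def comap (φ : F ⟶ G) (Q : SubFunctor G) : SubFunctor F where
  obj X := (Q.obj X).comap (φ.app X).hom
  le_comap X Y f x hx := by
    have hnat : (φ.app Y).hom ((F.map f).hom x) = (G.map f).hom ((φ.app X).hom x) :=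
      NatTrans.naturality_apply φ f x
    rw [Submodule.mem_comap, Submodule.mem_comap, hnat]
    exact Q.le_comap f hx

/-- The restriction of a natural transformation to the preimage of a subfunctor. -/
def comapHom (φ : F ⟶ G) (Q : SubFunctor G) : (Q.comap φ).toFunctor ⟶ Q.toFunctor where
  app X := ModuleCat.ofHom ((φ.app X).hom.restrict fun _ hx => hx)
  naturality X Y f := by
    ext x
    exact Subtype.ext (NatTrans.naturality_apply φ f x.1)

instance mono_comapHom (φ : F ⟶ G) [Mono φ] (Q : SubFunctor G) : Mono (Q.comapHom φ) :=
  (NatTrans.mono_iff_mono_app _).2 fun X => (ModuleCat.mono_iff_injective _).2 fun _ _ h =>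
    Subtype.ext (app_injective_of_mono φ X (congrArg Subtype.val h))

theorem isIso_incl_of_simple [Simple F] (Q : SubFunctor F) {X : Elem S} {x : F.obj X}
    (hx : x ∈ Q.obj X) (hx₀ : x ≠ 0) : IsIso Q.incl :=
  isIso_of_mono_of_nonzero fun h =>
    hx₀ (congrArg (fun φ => (φ.app X).hom (⟨x, hx⟩ : Q.obj X)) h)

end SubFunctor

theorem preservesFilteredColimitsOfSize_forget_moduleCat (R : Type*) [Ring R] :
    PreservesFilteredColimitsOfSize.{u, u} (CategoryTheory.forget (ModuleCat.{u} R)) where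
  preserves_filtered_colimits J _ _ := inferInstanceAs (PreservesColimitsOfShape J
    (forget₂ (ModuleCat.{u} R) AddCommGrpCat.{u} ⋙ CategoryTheory.forget AddCommGrpCat.{u}))

theorem isAnalytic_iff_forall_exists_mem_polyPart :
    IsAnalytic F ↔ ∀ X (x : F.obj X), ∃ n, x ∈ (polyPart F n).obj X := by
  have := preservesFilteredColimitsOfSize_forget_moduleCat.{u} k
  have : PreservesFilteredColimitsOfSize.{0, 0} (CategoryTheory.forget (ModuleCat.{u} k)) :=
    preservesFilteredColimitsOfSize_shrink.{0, u, 0, u} _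
  have : ReflectsColimitsOfShape ℕ (CategoryTheory.forget (ModuleCat.{u} k)) :=
    reflectsColimitsOfShape_of_reflectsIsomorphisms
  constructor
  · rintro ⟨hF⟩ X x
    obtain ⟨n, y, rfl⟩ := Types.jointly_surjective_of_isColimit
      (isColimitOfPreserves ((evaluation _ _).obj X ⋙ CategoryTheory.forget (ModuleCat k)) hF) x
    exact ⟨n, y.2⟩
  · refine fun hF => ⟨evaluationJointlyReflectsColimits _ fun X =>
      isColimitOfReflects (CategoryTheory.forget (ModuleCat k))
        (Types.FilteredColimit.isColimitOf' _ _ ?_ ?_)⟩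
    · intro x
      obtain ⟨n, hx⟩ := hF X x
      exact ⟨n, ⟨x, hx⟩, rfl⟩
    · exact fun n x y h => ⟨n, 𝟙 n, congrArg _ (Subtype.ext h)⟩

theorem isPoly_of_simple_of_isAnalytic [Simple F] (hG : IsAnalytic G) {φ : F ⟶ G} {X : Elem S}
    {x : F.obj X} (hx : (φ.app X).hom x ≠ 0) : IsPoly F := by
  obtain ⟨n, hn⟩ := isAnalytic_iff_forall_exists_mem_polyPart.1 hG X ((φ.app X).hom x)
  have : Mono φ := mono_of_nonzero_from_simple fun h => hx (by rw [h]; rfl)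
  have hx₀ : x ≠ 0 := fun h => hx (by rw [h, map_zero])
  have : IsIso ((polyPart G n).comap φ).incl := SubFunctor.isIso_incl_of_simple _ hn hx₀
  have : Mono (inv ((polyPart G n).comap φ).incl) := IsIso.mono_of_iso _
  exact ⟨n, (isGreatest_polyPart G n).1.of_mono
    (inv ((polyPart G n).comap φ).incl ≫ (polyPart G n).comapHom φ)⟩

end FunctorCat

section CoRep

variable {k : Type} [Field k] {S : VPresheaf.{u, w} k} {F G : FunctorCat S} {X Y : Elem S}

variable (F X) in
/-- The Yoneda type description of the natural transformations into `I_X = k^{Hom(-, X)}`: they are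
the linear forms on `F(X)`. -/
def coRepHomEquiv : (F ⟶ coRep X) ≃ Module.Dual k (F.obj X) where
  toFun φ := LinearMap.proj (R := k) (φ := fun _ : X ⟶ X => k) (𝟙 X) ∘ₗ (φ.app X).hom
  invFun l :=
    { app := fun Y => ModuleCat.ofHom (LinearMap.pi fun g : Y ⟶ X => l ∘ₗ (F.map g).hom)
      naturality := fun Y Z f => by
        ext x
        funext g
        exact (congrArg (fun f => l (f.hom x)) (F.map_comp f g)).symm }
  left_inv φ := by
    ext Y x
    funext g
    have hnat := congrArg (fun f => (f.hom x : (X ⟶ X) → k) (𝟙 X)) (φ.naturality g)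
    exact hnat.trans (congrArg ((φ.app Y).hom x : (Y ⟶ X) → k) (Category.comp_id g))
  right_inv l := by
    ext x
    exact congrArg (fun f => l (f.hom x)) (F.map_id X)

theorem coRepHomEquiv_comp (f : F ⟶ G) (φ : G ⟶ coRep X) :
    coRepHomEquiv F X (f ≫ φ) = (f.app X).hom.dualMap (coRepHomEquiv G X φ) := rfl

theorem injective_coRep (X : Elem S) : Injective (coRep X) where
  factors {F G} φ f _ := by
    obtain ⟨l, hl⟩ := LinearMap.dualMap_surjective_of_injective (app_injective_of_mono f X)
      (coRepHomEquiv F X φ)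
    refine ⟨(coRepHomEquiv G X).symm l, (coRepHomEquiv F X).injective ?_⟩
    rw [coRepHomEquiv_comp, Equiv.apply_symm_apply, hl]

theorem exists_hom_coRep_app_ne_zero (g : Y ⟶ X) {y : F.obj Y} (hy : (F.map g).hom y ≠ 0) :
    ∃ φ : F ⟶ coRep X, (φ.app Y).hom y ≠ 0 := by
  obtain ⟨l, hl⟩ := Module.Projective.exists_dual_ne_zero k hy
  exact ⟨(coRepHomEquiv F X).symm l, fun h => hl (congrFun h g)⟩

end CoRep

section Elements

variable {k : Type} [Field k] {S : VPresheaf.{u, w} k} {X Y Z : Elem S} {V L : FGModuleCat.{u} k}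

theorem pull_lin_comp {U : FGModuleCat.{u} k} (f : Y ⟶ X) (α : U →ₗ[k] Y.space) :
    pull S (Elem.lin f ∘ₗ α) X.elt = pull S α Y.elt := by
  rw [← pull_pull, Elem.pull_lin]

/-- An isomorphism of `𝔖_S` from a linear equivalence of the underlying spaces. -/
def Elem.isoMk (e : X.space ≃ₗ[k] Y.space) (he : pull S e.toLinearMap Y.elt = X.elt) : X ≅ Y where
  hom := Elem.homMk e.toLinearMap he
  inv := Elem.homMk e.symm.toLinearMap (by
    rw [← he, pull_pull, e.comp_symm]
    exact pull_id S Y.elt)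
  hom_inv_id := Elem.hom_ext e.symm_comp
  inv_hom_id := Elem.hom_ext e.comp_symm

theorem isRegular_of_pull_mkQ_ker (hS : WeaklyNoetherian S) {U : FGModuleCat.{u} k}
    {s : S.obj (op U)} {t : S.obj (op (FGModuleCat.of k (U ⧸ ker S s)))}
    (hs : s = pull S (W := FGModuleCat.of k (U ⧸ ker S s)) (ker S s).mkQ t) : IsRegular S t := by
  have hcomap : ker S s = (ker S t).comap (ker S s).mkQ :=
    (congrArg (ker S) hs).trans (hS (V := FGModuleCat.of k (U ⧸ ker S s)) _ t)
  rw [IsRegular, ← Submodule.map_comap_eq_of_surjective (ker S s).mkQ_surjective (ker S t),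
    ← hcomap]
  exact Submodule.mkQ_map_self _

theorem exists_isRegular_iso_boxObj (hS : WeaklyNoetherian S) (X : Elem S) :
    ∃ (W : FGModuleCat.{u} k) (ψ : S.obj (op W)) (V : FGModuleCat.{u} k),
      IsRegular S ψ ∧ Nonempty (X ≅ (Elem.mk S W ψ).boxObj V) := by
  obtain ⟨ψ, hψ⟩ := exists_eq_pull_mkQ_ker S X.elt
  obtain ⟨E, hE⟩ := exists_isCompl (ker S X.elt)
  let U := ker S X.elt
  let e : X.space ≃ₗ[k] (X.space ⧸ U) × U :=
    LinearMap.equivProdOfSurjectiveOfIsCompl U.mkQ (U.projectionOnto E hE) U.range_mkQ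
      (Submodule.range_projectionOnto hE)
      (by rw [U.ker_mkQ, Submodule.ker_projectionOnto]; exact hE)
  refine ⟨_, ψ, FGModuleCat.of k U, isRegular_of_pull_mkQ_ker hS hψ, ⟨Elem.isoMk e ?_⟩⟩
  exact (pull_lin_comp ((Elem.mk S _ ψ).proj (FGModuleCat.of k U)) _).symm.trans hψ.symm

theorem ker_elt_eq_ker_lin (hS : WeaklyNoetherian S) (hX : IsRegular S X.elt) (f : Y ⟶ X) :
    ker S Y.elt = LinearMap.ker (Elem.lin f) := by
  rw [← Elem.pull_lin f, hS, hX]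
  rfl

/-- The translation action of `Hom(Y, V)` on the morphisms `Y ⟶ (W ⊕ V, ψ ⊞ ε_V)`. Without
`no_index` the instance is not found for `Y = (H ⊕ L, η ⊞ ε_L)`, whose space is reduced to a product
in the index of instances. -/
instance : AddAction (no_index (Y.space →ₗ[k] V)) (Y ⟶ no_index (X.boxObj V)) where
  vadd b g := Elem.homMk (Elem.lin g + LinearMap.inr k X.space V ∘ₗ b) (by
    have hfst : Elem.lin (X.proj V) ∘ₗ (Elem.lin g + LinearMap.inr k X.space V ∘ₗ b) =
        Elem.lin (X.proj V) ∘ₗ Elem.lin g := by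
      ext y
      exact add_zero _
    rw [← pull_lin_comp (X.proj V), hfst, pull_lin_comp, Elem.pull_lin])
  zero_vadd g := Elem.hom_ext (by
    change Elem.lin g + LinearMap.inr k X.space V ∘ₗ 0 = Elem.lin g
    rw [LinearMap.comp_zero, add_zero])
  add_vadd b c g := Elem.hom_ext (by
    change Elem.lin g + LinearMap.inr k X.space V ∘ₗ (b + c) =
      (Elem.lin g + LinearMap.inr k X.space V ∘ₗ c) + LinearMap.inr k X.space V ∘ₗ b
    rw [LinearMap.comp_add, add_comm (LinearMap.comp _ b), add_assoc])

theorem comp_vadd (f : Y ⟶ Z) (b : Z.space →ₗ[k] V) (g : Z ⟶ X.boxObj V) :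
    f ≫ (b +ᵥ g) = (b ∘ₗ Elem.lin f) +ᵥ (f ≫ g) :=
  Elem.hom_ext rfl

/-- The projection `W ⊕ V → V`, which in general is not a morphism of `𝔖_S`. -/
def Elem.snd (X : Elem S) (V : FGModuleCat.{u} k) : (X.boxObj V).space →ₗ[k] V :=
  LinearMap.snd k X.space V

theorem exists_eq_vadd_proj_comp (hS : WeaklyNoetherian S) (hX : IsRegular S X.elt)
    (g : Y.boxObj L ⟶ X.boxObj V) :
    ∃ (b : L →ₗ[k] V) (g₀ : Y ⟶ X.boxObj V), g = (b ∘ₗ Y.snd L) +ᵥ (Y.proj L ≫ g₀) := by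
  have hfst (y : L) : (Elem.lin g (0, y)).1 = 0 := by
    have hker : LinearMap.ker (Elem.lin (g ≫ X.proj V)) =
        (ker S Y.elt).comap (LinearMap.fst k Y.space L) :=
      (ker_elt_eq_ker_lin hS hX _).symm.trans (hS (U := (Y.boxObj L).space) _ _)
    exact hker.ge (show _ ∈ ker S Y.elt from Submodule.zero_mem _)
  refine ⟨X.snd V ∘ₗ Elem.lin g ∘ₗ LinearMap.inr k Y.space L, Y.incl L ≫ g, Elem.hom_ext ?_⟩
  refine LinearMap.ext fun ⟨x, y⟩ => ?_
  have hadd : ((x, y) : Y.space × L) = (x, 0) + (0, y) := by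
    rw [Prod.mk_add_mk, add_zero, zero_add]
  calc Elem.lin g (x, y) = Elem.lin g (x, 0) + Elem.lin g (0, y) :=
        (congrArg (Elem.lin g) hadd).trans (map_add (Elem.lin g) _ _)
    _ = Elem.lin g (x, 0) + (0, (Elem.lin g (0, y)).2) :=
        congrArg (Elem.lin g (x, 0) + ·) (Prod.ext (hfst y) rfl)

end Elements

section Degree

variable {k : Type} [Field k] {S : VPresheaf.{u, w} k} {X : Elem S} {V : FGModuleCat.{u} k}

variable (X V) in
/-- The subfunctor of `I_{(W ⊕ V, ψ ⊞ ε_V)}` formed by the functions of degree less than `n` for the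
translations by `Hom(-, V)`. -/
def degLT (n : ℕ) : SubFunctor (coRep (X.boxObj V)) where
  obj Y := degreeLT (Y.space →ₗ[k] V) (Y ⟶ X.boxObj V) k n
  le_comap _ _ f _ := comp_mem_degreeLT (· ∘ₗ Elem.lin f) (f ≫ ·) (comp_vadd f)

variable (X V) in
/-- The restriction to `Hom(Y, (W ⊕ V, ψ ⊞ ε_V))` of the difference, in the direction `b`, of a
function on `Hom(Y ⊕ k, (W ⊕ V, ψ ⊞ ε_V))`. -/
def slice (n : ℕ) (b : line k →ₗ[k] V) :
    Delta (degLT X V (n + 1)).toFunctor ⟶ (degLT X V n).toFunctor where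
  app Y := ModuleCat.ofHom (((coRep (X.boxObj V)).map (Y.proj (line k))).hom.restrict
      ((degLT X V n).le_comap (Y.proj (line k))) ∘ₗ
    (difference k (b ∘ₗ Y.snd (line k))).restrict (fun _ hf => mem_degreeLT_succ.1 hf _) ∘ₗ
    (LinearMap.ker ((degLT X V (n + 1)).toFunctor.map (Y.proj (line k))).hom).subtype)
  naturality _ _ _ := rfl

theorem eq_zero_of_forall_slice_eq_zero (hS : WeaklyNoetherian S) (hX : IsRegular S X.elt) {n : ℕ}
    {Y : Elem S} {f : (Delta (degLT X V (n + 1)).toFunctor).obj Y}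
    (hf : ∀ b, ((slice X V n b).app Y).hom f = 0) : f = 0 := by
  refine Subtype.ext (Subtype.ext (funext fun g => ?_))
  obtain ⟨b, g₀, rfl⟩ := exists_eq_vadd_proj_comp hS hX g
  have hproj : f.1.1 (Y.proj (line k) ≫ g₀) = 0 := congrFun (congrArg Subtype.val f.2) g₀
  have hslice : f.1.1 ((b ∘ₗ Y.snd (line k)) +ᵥ (Y.proj (line k) ≫ g₀)) -
      f.1.1 (Y.proj (line k) ≫ g₀) = 0 := congrFun (congrArg Subtype.val (hf b)) g₀
  rwa [hproj, sub_zero] at hslice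

theorem isZero_Delta_iterate_degLT (hS : WeaklyNoetherian S) (hX : IsRegular S X.elt) (n : ℕ) :
    IsZero (Delta^[n] (degLT X V n).toFunctor) := by
  induction n with
  | zero => exact isZero_iff_forall_eq_zero.2 fun _ f => Subtype.ext f.2
  | succ n ih =>
    rw [Function.iterate_succ_apply]
    exact isZero_Delta_iterate_of_jointly_injective (slice X V n)
      (fun _ _ => eq_zero_of_forall_slice_eq_zero hS hX) fun _ => ih

theorem degLT_le_polyPart (hS : WeaklyNoetherian S) (hX : IsRegular S X.elt) (n : ℕ) :
    degLT X V n ≤ polyPart (coRep (X.boxObj V)) n := by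
  refine (isGreatest_polyPart _ n).2 ?_
  rw [Set.mem_ofPred_eq, IsPolyOfDegreeLE, Function.iterate_succ_apply']
  exact Delta_isZero (isZero_Delta_iterate_degLT hS hX n)

theorem exists_degLT_obj_eq_top [Finite k] (Y : Elem S) : ∃ n, (degLT X V n).obj Y = ⊤ := by
  obtain ⟨p, _⟩ := CharP.exists k
  have : Fact p.Prime := ⟨CharP.char_is_prime k p⟩
  have : Finite (Y.space →ₗ[k] V) := Module.finite_of_finite k
  refine exists_degreeLT_eq_top p fun b => ⟨1, ?_⟩
  rw [pow_one, ← Nat.cast_smul_eq_nsmul k, CharP.cast_eq_zero, zero_smul]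

theorem isAnalytic_coRep_boxObj [Finite k] (hS : WeaklyNoetherian S) (hX : IsRegular S X.elt)
    (V : FGModuleCat.{u} k) : IsAnalytic (coRep (X.boxObj V)) := by
  refine isAnalytic_iff_forall_exists_mem_polyPart.2 fun Y f => ?_
  obtain ⟨n, hn⟩ := exists_degLT_obj_eq_top (X := X) (V := V) Y
  exact ⟨n, degLT_le_polyPart hS hX n Y (hn.ge Submodule.mem_top)⟩

end Degree

section Cogenerators

variable {k : Type} [Field k] {S : VPresheaf.{u, w} k} {F : FunctorCat S}

theorem exists_isStandardInjective_app_ne_zero (hS : WeaklyNoetherian S) {Y : Elem S} {x : F.obj Y}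
    (hx : x ≠ 0) :
    ∃ G, IsStandardInjective S G ∧ ∃ φ : F ⟶ G, (φ.app Y).hom x ≠ 0 := by
  obtain ⟨W, ψ, V, hψ, ⟨e⟩⟩ := exists_isRegular_iso_boxObj hS Y
  refine ⟨_, ⟨W, ψ, hψ, V⟩, exists_hom_coRep_app_ne_zero e.hom ?_⟩
  exact (map_ne_zero_iff _ ((ModuleCat.mono_iff_injective (F.map e.hom)).1 inferInstance)).2 hx

theorem isCoseparating_isStandardInjective (hS : WeaklyNoetherian S) :
    ObjectProperty.IsCoseparating (IsStandardInjective S) := by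
  intro F G f g hfg
  ext Y x
  by_contra hne
  obtain ⟨H, hH, φ, hφ⟩ := exists_isStandardInjective_app_ne_zero hS (sub_ne_zero.2 hne)
  rw [map_sub, sub_ne_zero] at hφ
  exact hφ (congrArg (fun f => (f.app Y).hom x) (hfg H hH φ))

theorem isPoly_of_simple [Finite k] (hS : WeaklyNoetherian S) [Simple F] : IsPoly F := by
  obtain ⟨Y, x, hx⟩ : ∃ Y, ∃ x : F.obj Y, x ≠ 0 := by
    by_contra! h
    exact Simple.not_isZero F (isZero_iff_forall_eq_zero.2 h)
  obtain ⟨_, ⟨W, ψ, hψ, V⟩, φ, hφ⟩ := exists_isStandardInjective_app_ne_zero hS hx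
  exact isPoly_of_simple_of_isAnalytic (isAnalytic_coRep_boxObj hS hψ V) hφ

end Cogenerators

end PolyElem

end

theorem mainTheorem5_general {k : Type} [Field k] [Finite k] (S : PolyElem.VPresheaf.{u, w} k)
    (hS : PolyElem.WeaklyNoetherian S) :
    (∀ (W : FGModuleCat.{u} k) (ψ : S.obj (op W)), PolyElem.IsRegular S ψ →
      ∀ V : FGModuleCat.{u} k,
        Injective (PolyElem.coRep ((PolyElem.Elem.mk S W ψ).boxObj V)) ∧
        PolyElem.IsAnalytic (PolyElem.coRep ((PolyElem.Elem.mk S W ψ).boxObj V))) ∧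
    ObjectProperty.IsCoseparating (PolyElem.IsStandardInjective S) ∧
    (∀ F : PolyElem.FunctorCat S, Simple F → PolyElem.IsPoly F) :=
  ⟨fun _ _ hψ V => ⟨PolyElem.injective_coRep _, PolyElem.isAnalytic_coRep_boxObj hS hψ V⟩,
    PolyElem.isCoseparating_isStandardInjective hS, fun _ _ => PolyElem.isPoly_of_simple hS⟩

theorem mainTheorem5 (p : ℕ) [Fact p.Prime] (S : PolyElem.VPresheaf.{u, w} (ZMod p))
    (hS : PolyElem.WeaklyNoetherian S) :
    (∀ (W : FGModuleCat.{u} (ZMod p)) (ψ : S.obj (op W)), PolyElem.IsRegular S ψ →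
      ∀ V : FGModuleCat.{u} (ZMod p),
        Injective (PolyElem.coRep ((PolyElem.Elem.mk S W ψ).boxObj V)) ∧
        PolyElem.IsAnalytic (PolyElem.coRep ((PolyElem.Elem.mk S W ψ).boxObj V))) ∧
    ObjectProperty.IsCoseparating (PolyElem.IsStandardInjective S) ∧
    (∀ F : PolyElem.FunctorCat S, Simple F → PolyElem.IsPoly F) :=
  mainTheorem5_general S hS
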